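/- **Theorem (CONGEST $\varepsilon$-tester for $T$-freeness).** There are absolute constants $C,B$ such that for every $\varepsilon>0$ there is a randomized distributed algorithm which, given a tree $T$ as common input to all processors, is a one-sided $\varepsilon$-tester for $T$-freeness in the $\mathsf{CONGEST}$ model, and which runs for at most $C\,k^{k^2+1}\varepsilon^{-k}$ rounds, where $k$ is the number of vertices of $T$; that is, its round complexity is $O(k^{k^2+1}\varepsilon^{-k})$. Here the network is an arbitrary finite simple graph $G=(V,E)$ with $n=|V|$. Each vertex is a processor that initially knows the common input, $n$, its own identifier (a natural number, distinct from those of the other processors), its number of incident links (which are numbered locally in an arbitrary order), and a private random element of a finite set (which may depend on the input and on $n$), drawn uniformly and independently of the other processors. In each synchronous round every processor performs an unrestricted local computation and sends to each of its neighbours a (possibly empty, possibly different) message of at most $B\log_2 n$ bits; after the last round every processor outputs ACCEPT or REJECT. A graph is $T$-free if it has no (not necessarily induced) subgraph isomorphic to $T$. A graph $G$ is $\varepsilon$-far from $T$-freeness if it is not $T$-free and every $T$-free graph $G'$ on the vertex set $V$ satisfies $|E(G)\,\triangle\, E(G')|\ge\varepsilon|E(G)|$. The algorithm is a one-sided $\varepsilon$-tester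 for $T$-freeness if, for every network $G$, every assignment of distinct identifiers and every local numbering of the links: (i) if $G$ is $T$-free, then all processors output ACCEPT, whatever the random choices; (ii) if $G$ is $\varepsilon$-far from $T$-freeness, then with probability at least $2/3$ at least one processor outputs REJECT. -/

import Mathlib

/-!
The distributed CONGEST model, testers in this model (in the general graph model), and
the inputs of a tester for tree-freeness.
-/

/-- The local output of a processor. -/
inductive Verdict where
  | accept
  | reject

/-- A finite network on the graph `G`. Every vertex is a processor and every edge is a
communication link. Processor `v` has an identifier `id v`, distinct from all others, and its
`deg v` incident links are attached to the local ports `0, …, deg v - 1` in an arbitrary order. -/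
structure Network {V : Type} (G : SimpleGraph V) where
  id : V → ℕ
  id_injective : Function.Injective id
  deg : V → ℕ
  port : (v : V) → Fin (deg v) ≃ G.neighborSet v

/-- A randomized synchronous message passing algorithm; all processors run the same program and
receive a common input of type `Input`. Local computation is unrestricted. Messages are bit
strings, `[]` being the empty message.

* `Coin x n` is the finite set from which each processor draws its private randomness, uniformly
  and independently of the other processors, on input `x` in a network with `n` processors.
* `init x n i d c` is the initial state of a processor with identifier `i`, `d` ports and private
  randomness `c`, on input `x` in a network with `n` processors.
* `send d s p` is the message which a processor in state `s` with `d` ports sends through port `p`.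
* `receive d s msg` is the new state of a processor in state `s` with `d` ports which receives the
  message `msg p` through port `p`, for every `p`.
* `rounds x n` is the number of rounds after which all processors stop.
* `output s` is the local output of a processor that stops in state `s`. -/
structure DistributedAlgorithm (Input : Type) where
  State : Type
  Coin : Input → ℕ → Type
  coin_finite : ∀ x n, Finite (Coin x n)
  coin_nonempty : ∀ x n, Nonempty (Coin x n)
  init : (x : Input) → (n i d : ℕ) → Coin x n → State
  send : (d : ℕ) → State → Fin d → List Bool
  receive : (d : ℕ) → State → (Fin d → List Bool) → State
  rounds : Input → ℕ → ℕ
  output : State → Verdict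

namespace DistributedAlgorithm

variable {Input : Type}

/-- The sample space of an execution: one independent private coin per processor. -/
abbrev Coins (A : DistributedAlgorithm Input) (x : Input) (V : Type) [Fintype V] : Type :=
  V → A.Coin x (Fintype.card V)

/-- The port of the `p`-th neighbour of `v` that leads back to `v`. -/
def backPort {V : Type} {G : SimpleGraph V} (N : Network G) (v : V) (p : Fin (N.deg v)) :
    Fin (N.deg (N.port v p)) :=
  (N.port (N.port v p)).symm ⟨v, (N.port v p).2.symm⟩

/-- The states of all processors after `t` rounds, when the coins are `ω`. In each round every
processor sends a message through each of its ports, and then receives the messages which its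
neighbours have sent to it. -/
def config (A : DistributedAlgorithm Input) (x : Input) {V : Type} [Fintype V]
    {G : SimpleGraph V} (N : Network G) (ω : A.Coins x V) : ℕ → V → A.State
  | 0 => fun v => A.init x (Fintype.card V) (N.id v) (N.deg v) (ω v)
  | t + 1 => fun v =>
      A.receive (N.deg v) (config A x N ω t v) fun p =>
        A.send (N.deg (N.port v p)) (config A x N ω t (N.port v p)) (backPort N v p)

/-- The local output of processor `v`. -/
def verdict (A : DistributedAlgorithm Input) (x : Input) {V : Type} [Fintype V]
    {G : SimpleGraph V} (N : Network G) (ω : A.Coins x V) (v : V) : Verdict :=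
  A.output (A.config x N ω (A.rounds x (Fintype.card V)) v)

/-- The probability of an event, over the independent uniform coins of the processors. -/
noncomputable def prob (A : DistributedAlgorithm Input) (x : Input) (V : Type) [Fintype V]
    (E : Set (A.Coins x V)) : ℝ :=
  (E.ncard : ℝ) / (Nat.card (A.Coins x V) : ℝ)

/-- On input `x`, in every execution on every network with `n` processors, every message has at
most `B * log₂ n` bits. -/
def CongestBound (A : DistributedAlgorithm Input) (x : Input) (B : ℝ) : Prop :=
  ∀ (V : Type) [Fintype V] (G : SimpleGraph V) (N : Network G) (ω : A.Coins x V) (t : ℕ),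
    t < A.rounds x (Fintype.card V) → ∀ (v : V) (p : Fin (N.deg v)),
      ((A.send (N.deg v) (A.config x N ω t v) p).length : ℝ)
        ≤ B * Real.logb 2 (Fintype.card V)

end DistributedAlgorithm

/-- A graph `G` is `ε`-far from the property `P` (general graph model) if it does not have `P` and
at least `ε * |E(G)|` edges must be added or removed in order to obtain `P`. The first clause
matters only when `G` has no edges. -/
def IsFar (P : (V : Type) → SimpleGraph V → Prop) (ε : ℝ) {V : Type} (G : SimpleGraph V) : Prop :=
  ¬ P V G ∧ ∀ G' : SimpleGraph V, P V G' →
    ε * (G.edgeSet.ncard : ℝ) ≤ ((symmDiff G.edgeSet G'.edgeSet).ncard : ℝ)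

/-- On input `x`, the algorithm `A` is a one-sided `ε`-tester for the graph property `P` in the
general graph model: if the network graph has `P`, then all processors always accept, and if it is
`ε`-far from `P`, then with probability at least `2 / 3` some processor rejects. -/
def IsTester {Input : Type} (A : DistributedAlgorithm Input) (x : Input) (ε : ℝ)
    (P : (V : Type) → SimpleGraph V → Prop) : Prop :=
  ∀ (V : Type) [Fintype V] (G : SimpleGraph V) (N : Network G),
    (P V G → ∀ (ω : A.Coins x V) (v : V), A.verdict x N ω v = Verdict.accept) ∧
    (IsFar P ε G →
      2 / 3 ≤ A.prob x V {ω | ∃ v, A.verdict x N ω v = Verdict.reject})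

/-- A graph on the labelled vertices `v_0, …, v_{k-1}`, given together with its order `k`. -/
abbrev GraphInput : Type := (k : ℕ) × SimpleGraph (Fin k)

/-!
The tester searches for `T` by colour coding. Root `T` at its vertex `0` and let every processor
draw a vertex of `T` as its colour. Going through the vertices of `T` from the leaves to the root,
a processor of colour `i` beeps as soon as it has heard a beep for every child of `i`; the round in
which a beep is heard tells for which vertex it is. A processor of colour `0` which hears all
children of the root is the image of the root under a homomorphism from `T` which follows the
colours. Different vertices of `T` have images of different colours, so that the homomorphism is a
copy of `T`. Conversely, every copy is found if its `k` vertices have the right colours, and this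
happens with probability `k ^ (-k)`, so that `2 * k ^ k` repetitions suffice. Being `ε`-far matters
only for `1 < ε`, where the bound on the number of rounds can be less than `1`: removing all edges
shows that no graph is then `ε`-far from `T`-freeness, if `T` has an edge.
-/

open SimpleGraph

section RootedTree

variable {V W : Type*} {T : SimpleGraph W}

theorem exists_adj_dist_lt (hT : T.Connected) {ρ j : W} (hj : j ≠ ρ) :
    ∃ i, T.Adj i j ∧ T.dist ρ i < T.dist ρ j := by
  obtain ⟨p, hp⟩ := hT.exists_walk_length_eq_dist ρ j
  have hnil : ¬ p.Nil := Walk.not_nil_of_ne hj.symm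
  refine ⟨p.penultimate, p.adj_penultimate hnil, ?_⟩
  have := dist_le p.dropLast
  have := p.length_dropLast_add_one hnil
  omega

theorem eq_of_adj_of_dist_lt (hT : T.IsTree) {ρ i i' j : W} (hi : T.Adj i j) (hi' : T.Adj i' j)
    (hlt : T.dist ρ i < T.dist ρ j) (hlt' : T.dist ρ i' < T.dist ρ j) : i = i' := by
  have exists_path_through {i : W} (hi : T.Adj i j) (hlt : T.dist ρ i < T.dist ρ j) :
      ∃ p : T.Walk ρ j, p.IsPath ∧ p.penultimate = i := by
    obtain ⟨q, hq⟩ := hT.connected.exists_walk_length_eq_dist ρ i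
    refine ⟨q.concat hi, Walk.isPath_of_length_eq_dist _ ?_, q.penultimate_concat hi⟩
    have := hT.dist_eq_dist_add_one_of_adj ρ hi
    rw [Walk.length_concat]
    omega
  obtain ⟨p, hp, rfl⟩ := exists_path_through hi hlt
  obtain ⟨p', hp', rfl⟩ := exists_path_through hi' hlt'
  rw [(hT.existsUnique_path ρ j).unique hp hp']

theorem exists_hom_of_forall_child (hT : T.IsTree) {G : SimpleGraph V} {ρ : W}
    {P : W → V → Prop} {v : V} (hroot : P ρ v)
    (hchild : ∀ i v, P i v → ∀ j, T.Adj i j → T.dist ρ i < T.dist ρ j → ∃ w, G.Adj v w ∧ P j w) :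
    ∃ φ : T →g G, ∀ i, P i (φ i) := by
  classical
  choose! parent hparent hlt using fun j (hj : j ≠ ρ) => exists_adj_dist_lt hT.connected hj
  choose! next hnext hP using hchild
  let φ : W → V := (measure (T.dist ρ)).wf.fix fun j ih =>
    if hj : j = ρ then v else next (parent j) (ih (parent j) (hlt j hj)) j
  have φ_eq (j : W) : φ j = if j = ρ then v else next (parent j) (φ (parent j)) j :=
    (measure (T.dist ρ)).wf.fix_eq _ j
  have hφ (j : W) : P j (φ j) := by
    induction j using (measure (T.dist ρ)).wf.induction with
    | _ j ih =>
      rw [φ_eq]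
      split_ifs with hj
      · exact hj ▸ hroot
      · exact hP _ _ (ih _ (hlt j hj)) _ (hparent j hj) (hlt j hj)
  have hadj {i j : W} (hij : T.Adj i j) (hd : T.dist ρ i < T.dist ρ j) : G.Adj (φ i) (φ j) := by
    have hj : j ≠ ρ := by
      rintro rfl
      simp at hd
    have hi : parent j = i := eq_of_adj_of_dist_lt hT (hparent j hj) hij (hlt j hj) hd
    rw [φ_eq j, if_neg hj, hi]
    exact hnext i _ (hφ i) j hij hd
  refine ⟨⟨φ, fun {i j} hij => ?_⟩, hφ⟩
  rcases (hT.dist_ne_of_adj ρ hij).lt_or_gt with hd | hd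
  · exact hadj hij hd
  · exact (hadj hij.symm hd).symm

theorem dist_lt_card [Fintype W] (hT : T.Connected) (u v : W) : T.dist u v < Fintype.card W := by
  obtain ⟨p, hp, hlen⟩ := hT.exists_path_of_dist u v
  exact hlen ▸ hp.length_lt

end RootedTree

section UniformProbability

variable {α β ι : Type*}

/-- The probability of `E` under the uniform distribution on the finite type `α`. For the coins of a
distributed algorithm this is `DistributedAlgorithm.prob` by definition. -/
noncomputable def uniformProb (E : Set α) : ℝ := E.ncard / Nat.card α

theorem uniformProb_mono [Finite α] {E F : Set α} (h : E ⊆ F) :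
    uniformProb E ≤ uniformProb F :=
  div_le_div_of_nonneg_right (Nat.cast_le.2 (Set.ncard_le_ncard h)) (Nat.cast_nonneg _)

theorem uniformProb_univ [Finite α] [Nonempty α] : uniformProb (Set.univ : Set α) = 1 := by
  rw [uniformProb, Set.ncard_univ]
  exact div_self (Nat.cast_ne_zero.2 Nat.card_pos.ne')

theorem uniformProb_singleton (a : α) : uniformProb {a} = (Nat.card α : ℝ)⁻¹ := by
  rw [uniformProb, Set.ncard_singleton, Nat.cast_one, one_div]

theorem uniformProb_compl [Finite α] [Nonempty α] (E : Set α) :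
    uniformProb Eᶜ = 1 - uniformProb E := by
  rw [eq_sub_iff_add_eq', ← uniformProb_univ (α := α), uniformProb, uniformProb, uniformProb,
    ← add_div, Set.ncard_univ, ← Nat.cast_add, Set.ncard_add_ncard_compl]

theorem uniformProb_image_equiv (e : α ≃ β) (E : Set α) :
    uniformProb (e '' E) = uniformProb E := by
  rw [uniformProb, uniformProb, Set.ncard_image_of_injective E e.injective, Nat.card_congr e]

theorem uniformProb_univ_pi [Fintype ι] {α : ι → Type*} (E : (i : ι) → Set (α i)) :
    uniformProb (Set.univ.pi E) = ∏ i, uniformProb (E i) := by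
  simp only [uniformProb, ← Nat.card_coe_set_eq, Nat.card_congr (Equiv.Set.univPi E), Nat.card_pi,
    Nat.cast_prod, Finset.prod_div_distrib]

theorem uniformProb_exists_mem [Fintype ι] [Finite α] [Nonempty α] (E : Set α) :
    uniformProb {c : ι → α | ∃ i, c i ∈ E} = 1 - (1 - uniformProb E) ^ Fintype.card ι := by
  have hcompl : {c : ι → α | ∃ i, c i ∈ E} = (Set.univ.pi fun _ => Eᶜ)ᶜ := by
    ext c
    simp
  rw [hcompl, uniformProb_compl, uniformProb_univ_pi, Finset.prod_const, uniformProb_compl,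
    Finset.card_univ]

theorem uniformProb_forall_apply_eq [Fintype ι] [Finite β] [Finite α] [Nonempty α] (f : ι ↪ β)
    (g : ι → α) :
    uniformProb {c : β → α | ∀ i, c (f i) = g i} = (Nat.card α : ℝ)⁻¹ ^ Fintype.card ι := by
  have := Fintype.ofFinite β
  have hpi : {c : β → α | ∀ i, c (f i) = g i} =
      Set.univ.pi fun b => {a | ∀ i, f i = b → a = g i} := by
    ext c
    simp only [Set.mem_ofPred_eq, Set.mem_univ_pi]
    exact ⟨fun h b i hi => hi ▸ h i, fun h i => h (f i) i rfl⟩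
  have hrange (i : ι) : {a | ∀ j, f j = f i → a = g j} = {g i} := by
    ext a
    simp
  have hcompl (b : β) (hb : b ∉ Set.range f) : {a | ∀ i, f i = b → a = g i} = Set.univ :=
    Set.eq_univ_of_forall fun _ i hi => absurd ⟨i, hi⟩ hb
  calc uniformProb {c : β → α | ∀ i, c (f i) = g i}
      = ∏ b, uniformProb {a | ∀ i, f i = b → a = g i} := by rw [hpi, uniformProb_univ_pi]
    _ = ∏ _i : ι, (Nat.card α : ℝ)⁻¹ :=
        (Fintype.prod_of_injective f f.injective _ _
          (fun b hb => by rw [hcompl b hb, uniformProb_univ])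
          (fun i => by rw [hrange, uniformProb_singleton])).symm
    _ = _ := by rw [Finset.prod_const, Finset.card_univ]

theorem two_thirds_le_one_sub_one_sub_inv_pow {q : ℕ} (hq : 0 < q) :
    2 / 3 ≤ 1 - (1 - (q : ℝ)⁻¹) ^ (2 * q) := by
  have hq' : (1 : ℝ) ≤ q := Nat.one_le_cast.2 hq
  have hpow : (1 - (q : ℝ)⁻¹) ^ (2 * q) ≤ Real.exp (-2) := by
    have := Real.one_sub_div_pow_le_exp_neg (n := 2 * q) (t := 2) (by push_cast; linarith)
    rwa [Nat.cast_mul, Nat.cast_two, div_mul_cancel_left₀ two_ne_zero] at this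
  have hexp : Real.exp (-2) ≤ 1 / 3 := by
    rw [Real.exp_neg, one_div]
    exact inv_anti₀ (by norm_num) (by linarith [Real.add_one_le_exp 2])
  linarith

end UniformProbability

section Beeping

theorem exists_port_iff {V : Type} {G : SimpleGraph V} (N : Network G) (v : V) (Q : V → Prop) :
    (∃ p, Q (N.port v p)) ↔ ∃ w, G.Adj v w ∧ Q w :=
  ((N.port v).surjective.exists (p := fun w => Q w)).symm.trans (by simp)

/-- A distributed algorithm in which a processor beeps or stays silent in every round, and knows
nothing but the input, its own coin and the set of earlier rounds in which some neighbour has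
beeped. A beep is later encoded as a one-bit message to all neighbours. -/
structure BeepingProtocol (Input : Type) where
  Coin : Input → Type
  coin_finite : ∀ x, Finite (Coin x)
  coin_nonempty : ∀ x, Nonempty (Coin x)
  Beeps : (x : Input) → Coin x → (t : ℕ) → (heard : Set ℕ) → Prop
  Rejects : (x : Input) → Coin x → (heard : Set ℕ) → Prop
  rounds : Input → ℕ

namespace BeepingProtocol

variable {Input : Type} (P : BeepingProtocol Input) {x : Input} {V : Type} (G : SimpleGraph V)

/-- The rounds before round `t` in which `v` hears a beep, when the coins are `c`. -/
def heard (c : V → P.Coin x) : ℕ → V → Set ℕ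
  | 0, _ => ∅
  | t + 1, v => heard c t v ∪ {s | s = t ∧ ∃ w, G.Adj v w ∧ P.Beeps x (c w) t (heard c t w)}

/-- Processor `v` beeps in round `t`. -/
def BeepsAt (c : V → P.Coin x) (t : ℕ) (v : V) : Prop :=
  P.Beeps x (c v) t (P.heard G c t v)

theorem mem_heard {c : V → P.Coin x} {s t : ℕ} {v : V} :
    s ∈ P.heard G c t v ↔ s < t ∧ ∃ w, G.Adj v w ∧ P.BeepsAt G c s w := by
  induction t with
  | zero => simp [heard]
  | succ t ih =>
    rw [heard, Set.mem_union, ih, Nat.lt_succ_iff_lt_or_eq, or_and_right]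
    refine or_congr_right (and_congr_right ?_)
    rintro rfl
    rfl

/-- The local state of a processor that executes `P`. -/
structure State where
  input : Input
  coin : P.Coin input
  time : ℕ
  heard : Set ℕ

open Classical in
/-- The message passing algorithm which executes `P`. -/
noncomputable def toDistributedAlgorithm : DistributedAlgorithm Input where
  State := P.State
  Coin x _ := P.Coin x
  coin_finite x _ := P.coin_finite x
  coin_nonempty x _ := P.coin_nonempty x
  init x _ _ _ c := ⟨x, c, 0, ∅⟩
  send _ s _ := if P.Beeps s.input s.coin s.time s.heard then [true] else []
  receive _ s msg :=
    { s with time := s.time + 1, heard := s.heard ∪ {t | t = s.time ∧ ∃ p, msg p ≠ []} }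
  rounds x _ := P.rounds x
  output s := if P.Rejects s.input s.coin s.heard then .reject else .accept

variable [Fintype V] {G} (N : Network G)

theorem config_toDistributedAlgorithm (c : V → P.Coin x) (t : ℕ) (v : V) :
    P.toDistributedAlgorithm.config x N c t v = (⟨x, c v, t, P.heard G c t v⟩ : P.State) := by
  induction t generalizing v with
  | zero => rfl
  | succ t ih =>
    have hport := exists_port_iff N v (P.BeepsAt G c t)
    simp only [BeepsAt] at hport
    simp only [DistributedAlgorithm.config, ih]
    simp only [toDistributedAlgorithm, heard, ← hport, ne_eq, ite_eq_right_iff, List.cons_ne_nil,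
      imp_false, not_not]

theorem verdict_toDistributedAlgorithm_eq_reject_iff (c : V → P.Coin x) (v : V) :
    P.toDistributedAlgorithm.verdict x N c v = .reject ↔
      P.Rejects x (c v) (P.heard G c (P.rounds x) v) := by
  simp only [DistributedAlgorithm.verdict, config_toDistributedAlgorithm]
  simp [toDistributedAlgorithm]

theorem congestBound_toDistributedAlgorithm (x : Input) :
    P.toDistributedAlgorithm.CongestBound x 1 := by
  intro V _ G N c t _ v p
  have : Nontrivial V := ⟨v, N.port v p, (N.port v p).2.ne⟩
  have hcard : (2 : ℝ) ≤ Fintype.card V := by exact_mod_cast Fintype.one_lt_card (α := V)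
  have hlog : 1 ≤ Real.logb 2 (Fintype.card V) := by
    rwa [Real.le_logb_iff_rpow_le one_lt_two (by linarith), Real.rpow_one]
  have hlength (s : P.State) : (P.toDistributedAlgorithm.send (N.deg v) s p).length ≤ 1 := by
    simp only [toDistributedAlgorithm]
    split_ifs <;> simp
  rw [one_mul]
  exact (Nat.cast_le_one.2 (hlength _)).trans hlog

end BeepingProtocol

end Beeping

section TreeSearch

variable {k : ℕ} {T : SimpleGraph (Fin k)}

/-- The depth of `i` in the tree `T`, rooted at its vertex `0`. -/
noncomputable def depth (T : SimpleGraph (Fin k)) (i : Fin k) : ℕ := T.dist ⟨0, i.pos⟩ i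

/-- The round of repetition `r` in which the processors of colour `i` may beep. Deeper vertices come
first, vertices of the same depth are ordered by their labels, and only the root does not fit into
the `k * (k - 1)` rounds of the repetition. -/
noncomputable def beepTime (T : SimpleGraph (Fin k)) (r : ℕ) (i : Fin k) : ℕ :=
  k * ((k - 1) * r + (k - 1 - depth T i)) + i

theorem depth_lt (hT : T.Connected) (i : Fin k) : depth T i < k :=
  (dist_lt_card hT _ i).trans_eq (Fintype.card_fin k)

theorem beepTime_inj (hk : 1 < k) {r r' : ℕ} {i i' : Fin k} :
    beepTime T r i = beepTime T r' i' ↔ r = r' ∧ i = i' := by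
  refine ⟨fun h => ?_, fun ⟨hr, hi⟩ => hr ▸ hi ▸ rfl⟩
  have hi : i = i' := by
    have := congrArg (· % k) h
    simpa [beepTime, Nat.mod_eq_of_lt, Fin.ext_iff] using this
  subst hi
  have hk' : 0 < k - 1 := Nat.sub_pos_of_lt hk
  simpa [beepTime, hk'.ne', i.pos.ne'] using h

theorem beepTime_lt_of_depth_lt (hT : T.Connected) (r : ℕ) {i j : Fin k}
    (h : depth T i < depth T j) : beepTime T r j < beepTime T r i := by
  have hj := depth_lt hT j
  calc beepTime T r j < k * ((k - 1) * r + (k - 1 - depth T j)) + k :=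
        Nat.add_lt_add_left j.2 _
    _ = k * ((k - 1) * r + (k - 1 - depth T j + 1)) := by ring
    _ ≤ k * ((k - 1) * r + (k - 1 - depth T i)) := by gcongr; omega
    _ ≤ beepTime T r i := Nat.le_add_right _ _

theorem beepTime_lt_of_depth_pos (hT : T.Connected) {R r : ℕ} (hr : r < R) {j : Fin k}
    (h : 0 < depth T j) : beepTime T r j < k * ((k - 1) * R) := by
  have hj := depth_lt hT j
  calc beepTime T r j < k * ((k - 1) * r + (k - 1 - depth T j)) + k :=
        Nat.add_lt_add_left j.2 _
    _ = k * ((k - 1) * r + (k - 1 - depth T j + 1)) := by ring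
    _ ≤ k * ((k - 1) * r + (k - 1)) := by gcongr; omega
    _ = k * ((k - 1) * (r + 1)) := by ring
    _ ≤ k * ((k - 1) * R) := by gcongr; omega

/-- In repetition `r`, a processor with the given colours has colour `i` and has heard a beep from
every child of `i` in the tree `T`. If `T` is a tree, then this certifies that the subtree of `T`
below `i` can be mapped to the network with `i` at this processor. -/
def Completes (T : SimpleGraph (Fin k)) {R : ℕ} (color : Fin R → Fin (k - 1 + 1)) (heard : Set ℕ)
    (r : Fin R) (i : Fin k) : Prop :=
  (color r : ℕ) = i ∧ ∀ j, T.Adj i j → depth T i < depth T j → beepTime T r j ∈ heard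

/-- The search for a tree `T` with `k` vertices by colour coding, in `R k` independent repetitions.
In every repetition each processor draws one of `k` colours, that is, a vertex of `T`. The colours
are `Fin (k - 1 + 1)` and not `Fin k` because the set of coins must not be empty for `k = 0`. -/
noncomputable def treeSearch (R : ℕ → ℕ) : BeepingProtocol GraphInput where
  Coin x := Fin (R x.1) → Fin (x.1 - 1 + 1)
  coin_finite _ := inferInstance
  coin_nonempty _ := inferInstance
  Beeps x c t heard :=
    ∃ (r : Fin (R x.1)) (i : Fin x.1), t = beepTime x.2 r i ∧ Completes x.2 c heard r i
  Rejects x c heard :=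
    ∃ (r : Fin (R x.1)) (i : Fin x.1), (i : ℕ) = 0 ∧ Completes x.2 c heard r i
  rounds x := x.1 * ((x.1 - 1) * R x.1)

namespace treeSearch

variable {R : ℕ → ℕ} {V : Type} {G : SimpleGraph V} {c : V → Fin (R k) → Fin (k - 1 + 1)}

/-- The rounds before round `t` in which `v` hears a beep in the search for `T`, when the colours
are `c`. -/
abbrev heard (T : SimpleGraph (Fin k)) (G : SimpleGraph V) (c : V → Fin (R k) → Fin (k - 1 + 1))
    (t : ℕ) (v : V) : Set ℕ :=
  (treeSearch R).heard (x := ⟨k, T⟩) G c t v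

theorem beepsAt_beepTime_iff (hk : 1 < k) {r : Fin (R k)} {i : Fin k} {v : V} :
    (treeSearch R).BeepsAt (x := ⟨k, T⟩) G c (beepTime T r i) v ↔
      Completes T (c v) (heard T G c (beepTime T r i) v) r i := by
  refine ⟨?_, fun h => ⟨r, i, rfl, h⟩⟩
  rintro ⟨r', i', h, hcompletes⟩
  obtain ⟨hr, rfl⟩ := (beepTime_inj hk).1 h
  obtain rfl : r = r' := Fin.ext hr
  exact hcompletes

theorem isContained_of_completes (hT : T.IsTree) {r : Fin (R k)} {i : Fin k} (hi : (i : ℕ) = 0)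
    {t : ℕ} {v : V} (h : Completes T (c v) (heard T G c t v) r i) : T ⊑ G := by
  have hk : 0 < k := i.pos
  obtain rfl : i = ⟨0, hk⟩ := Fin.ext hi
  obtain ⟨φ, hφ⟩ := exists_hom_of_forall_child hT (G := G)
    (P := fun i v => ∃ t, Completes T (c v) (heard T G c t v) r i) ⟨t, h⟩ <| by
      rintro i v ⟨t, -, hheard⟩ j hij hd
      have hk : 1 < k := by
        have := Fin.val_ne_of_ne hij.ne
        omega
      obtain ⟨-, w, hvw, hbeep⟩ := ((treeSearch R).mem_heard G).1 (hheard j hij hd)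
      exact ⟨w, hvw, _, (beepsAt_beepTime_iff hk).1 hbeep⟩
  refine ⟨⟨φ, fun i j hij => Fin.ext ?_⟩⟩
  obtain ⟨-, hi, -⟩ := hφ i
  obtain ⟨-, hj, -⟩ := hφ j
  rw [← hi, ← hj, hij]

theorem beepsAt_of_copy (hT : T.Connected) (f : Copy T G) {r : Fin (R k)}
    (hf : ∀ i, (c (f i) r : ℕ) = i) (i : Fin k) :
    (treeSearch R).BeepsAt (x := ⟨k, T⟩) G c (beepTime T r i) (f i) := by
  induction i using (measure (beepTime T r)).wf.induction with
  | _ i ih =>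
    refine ⟨r, i, rfl, hf i, fun j hij hd => ((treeSearch R).mem_heard G).2 ?_⟩
    have hlt := beepTime_lt_of_depth_lt hT r hd
    exact ⟨hlt, f j, f.toHom.map_adj hij, ih j hlt⟩

variable [Fintype V]

theorem verdict_eq_accept_of_free (hT : T.IsTree) (N : Network G) (hfree : T.Free G) (v : V) :
    (treeSearch R).toDistributedAlgorithm.verdict ⟨k, T⟩ N c v = .accept := by
  cases h : (treeSearch R).toDistributedAlgorithm.verdict ⟨k, T⟩ N c v with
  | accept => rfl
  | reject =>
    obtain ⟨r, i, hi, hcompletes⟩ :=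
      ((treeSearch R).verdict_toDistributedAlgorithm_eq_reject_iff (x := ⟨k, T⟩) N c v).1 h
    exact absurd (isContained_of_completes hT hi hcompletes) hfree

theorem exists_verdict_eq_reject_of_copy (hT : T.Connected) (N : Network G) (f : Copy T G)
    {r : Fin (R k)} (hf : ∀ i, (c (f i) r : ℕ) = i) :
    ∃ v, (treeSearch R).toDistributedAlgorithm.verdict ⟨k, T⟩ N c v = .reject := by
  obtain ⟨i⟩ := hT.nonempty
  let root : Fin k := ⟨0, i.pos⟩
  refine ⟨f root,
    ((treeSearch R).verdict_toDistributedAlgorithm_eq_reject_iff (x := ⟨k, T⟩) N c _).2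
      ⟨r, root, rfl, hf root, fun j hj hd => ((treeSearch R).mem_heard G).2 ?_⟩⟩
  exact ⟨beepTime_lt_of_depth_pos hT r.2 (Nat.zero_lt_of_lt hd), f j, f.toHom.map_adj hj,
    beepsAt_of_copy hT f hf j⟩

theorem le_prob_reject_of_isContained (hT : T.Connected) (N : Network G) (h : T ⊑ G) :
    1 - (1 - ((k ^ k : ℕ) : ℝ)⁻¹) ^ R k ≤ (treeSearch R).toDistributedAlgorithm.prob ⟨k, T⟩ V
      {c | ∃ v, (treeSearch R).toDistributedAlgorithm.verdict ⟨k, T⟩ N c v = .reject} := by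
  obtain ⟨f⟩ := h
  have hk : k - 1 + 1 = k := Nat.sub_add_cancel (hT.nonempty.elim Fin.pos)
  let properlyColored : Set (V → Fin (k - 1 + 1)) := {c | ∀ i, c (f i) = Fin.cast hk.symm i}
  have hproper : uniformProb properlyColored = ((k ^ k : ℕ) : ℝ)⁻¹ :=
    (uniformProb_forall_apply_eq f.toEmbedding _).trans <| by
      rw [Nat.card_fin, hk, Fintype.card_fin, inv_pow, Nat.cast_pow]
  calc 1 - (1 - ((k ^ k : ℕ) : ℝ)⁻¹) ^ R k
      = uniformProb {c : Fin (R k) → V → Fin (k - 1 + 1) | ∃ r, c r ∈ properlyColored} := by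
        rw [uniformProb_exists_mem, hproper, Fintype.card_fin]
    _ = uniformProb (Equiv.piComm _ ''
          {c : Fin (R k) → V → Fin (k - 1 + 1) | ∃ r, c r ∈ properlyColored}) :=
        (uniformProb_image_equiv _ _).symm
    _ ≤ uniformProb {c : V → Fin (R k) → Fin (k - 1 + 1) |
          ∃ v, (treeSearch R).toDistributedAlgorithm.verdict ⟨k, T⟩ N c v = .reject} := by
        refine uniformProb_mono ?_
        rintro _ ⟨c, ⟨r, hr⟩, rfl⟩
        exact exists_verdict_eq_reject_of_copy hT N f fun i => congrArg Fin.val (hr i)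

end treeSearch

end TreeSearch

theorem not_isFar_of_one_lt {P : (V : Type) → SimpleGraph V → Prop} {ε : ℝ} (hε : 1 < ε) {V : Type}
    [Finite V] (hP : P V ⊥) (G : SimpleGraph V) : ¬ IsFar P ε G := by
  rintro ⟨hG, hfar⟩
  have hle := hfar ⊥ hP
  rw [edgeSet_bot, ← Set.bot_eq_empty, symmDiff_bot] at hle
  have hcard : (G.edgeSet.ncard : ℝ) = 0 := by
    have : (0 : ℝ) ≤ G.edgeSet.ncard := Nat.cast_nonneg _
    nlinarith
  rw [Nat.cast_eq_zero, Set.ncard_eq_zero, edgeSet_eq_empty] at hcard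
  exact hG (hcard ▸ hP)

theorem ne_bot_of_connected_of_nontrivial {V : Type*} [Nontrivial V] {G : SimpleGraph V}
    (hG : G.Connected) : G ≠ ⊥ := by
  rintro rfl
  exact not_preconnected_bot hG.preconnected

/-- The number of repetitions of the tester. For `1 < ε` and `1 < k` no graph is `ε`-far from
freeness of a tree with `k` vertices, and no repetition is needed. -/
noncomputable def repetitions (ε : ℝ) (k : ℕ) : ℕ := if 1 < ε ∧ 1 < k then 0 else 2 * k ^ k

theorem rounds_treeSearch_le {ε : ℝ} (hε : 0 < ε) {k : ℕ} (T : SimpleGraph (Fin k)) :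
    ((treeSearch (repetitions ε)).rounds ⟨k, T⟩ : ℝ) ≤ 2 * (k : ℝ) ^ (k ^ 2 + 1) * ε⁻¹ ^ k := by
  change ((k * ((k - 1) * repetitions ε k) : ℕ) : ℝ) ≤ _
  by_cases h1 : k ≤ 1
  · rw [Nat.sub_eq_zero_of_le h1, zero_mul, mul_zero, Nat.cast_zero]
    positivity
  have h2 := not_le.1 h1
  by_cases hε1 : 1 < ε
  · rw [repetitions, if_pos ⟨hε1, h2⟩, mul_zero, mul_zero, Nat.cast_zero]
    positivity
  have : (1 : ℝ) ≤ ε⁻¹ ^ k := one_le_pow₀ ((one_le_inv₀ hε).2 (not_lt.1 hε1))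
  rw [repetitions, if_neg fun h => hε1 h.1]
  calc ((k * ((k - 1) * (2 * k ^ k)) : ℕ) : ℝ)
      ≤ ((k * (k * (2 * k ^ k)) : ℕ) : ℝ) := by gcongr; exact Nat.sub_le k 1
    _ = 2 * (k : ℝ) ^ (k + 2) := by push_cast; ring
    _ ≤ 2 * (k : ℝ) ^ (k ^ 2 + 1) := by
      have hk : (1 : ℝ) ≤ k := Nat.one_le_cast.2 h2.le
      have hle : k + 2 ≤ k ^ 2 + 1 := by nlinarith
      gcongr
    _ ≤ _ := le_mul_of_one_le_right (by positivity) this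

theorem isTester_treeSearch {ε : ℝ} {k : ℕ} {T : SimpleGraph (Fin k)} (hT : T.IsTree) :
    IsTester (treeSearch (repetitions ε)).toDistributedAlgorithm ⟨k, T⟩ ε
      (fun _ G => T.Free G) := by
  refine fun V _ G N => ⟨fun hfree c v => treeSearch.verdict_eq_accept_of_free hT N hfree v,
    fun hfar => ?_⟩
  have hk : 0 < k := hT.connected.nonempty.elim Fin.pos
  have hR : repetitions ε k = 2 * k ^ k := if_neg fun ⟨hε, hk⟩ =>
    have : Nontrivial (Fin k) := Fin.nontrivial_iff_two_le.2 hk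
    not_isFar_of_one_lt (P := fun _ G => T.Free G) hε
      (free_bot (ne_bot_of_connected_of_nontrivial hT.connected)) G hfar
  calc (2 / 3 : ℝ) ≤ 1 - (1 - ((k ^ k : ℕ) : ℝ)⁻¹) ^ repetitions ε k :=
        hR ▸ two_thirds_le_one_sub_one_sub_inv_pow (pow_pos hk k)
    _ ≤ _ := treeSearch.le_prob_reject_of_isContained hT.connected N (not_free.1 hfar.1)

theorem mainTheorem8 :
    ∃ C B : ℝ, ∀ ε : ℝ, 0 < ε →
      ∃ A : DistributedAlgorithm GraphInput,
        ∀ (k : ℕ) (T : SimpleGraph (Fin k)), T.IsTree →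
          IsTester A ⟨k, T⟩ ε (fun _ G => T.Free G) ∧
          A.CongestBound ⟨k, T⟩ B ∧
          ∀ n : ℕ, (A.rounds ⟨k, T⟩ n : ℝ) ≤ C * (k : ℝ) ^ (k ^ 2 + 1) * ε⁻¹ ^ k :=
  ⟨2, 1, fun ε hε => ⟨(treeSearch (repetitions ε)).toDistributedAlgorithm, fun _ _ hT =>
    ⟨isTester_treeSearch hT, (treeSearch _).congestBound_toDistributedAlgorithm _,
      fun _ => rounds_treeSearch_le hε _⟩⟩⟩
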